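/- Let $\mathcal H$ be a real Hilbert space. For a real Hilbert space $E$, let $\Gamma_0(E)$ be the set of proper lower semicontinuous convex functions $g\colon E\to\,]-\infty,+\infty]$. For $g\in\Gamma_0(E)$ let $g^*(u)=\sup_{y\in E}(\langle y,u\rangle-g(y))$ be its conjugate, let $\operatorname{prox}_g(y)$ be the unique minimizer of $w\mapsto g(w)+\frac12\|y-w\|^2$, let $(\operatorname{rec} g)(y)=\lim_{t\to+\infty}\frac{g(y_0+ty)-g(y_0)}{t}$ be its recession function (for any $y_0$ with $g(y_0)<+\infty$), and let its perspective $\widetilde g\colon E\times\mathbb R\to\,]-\infty,+\infty]$ be $$\widetilde g(y,\eta)=\begin{cases}\eta\, g(y/\eta),&\eta>0;\\(\operatorname{rec} g)(y),&\eta=0;\\+\infty,&\eta<0.\end{cases}$$ Let $\operatorname{epi}\widetilde g=\{(y,\eta,\delta)\in E\times\mathbb R\times\mathbb R:\widetilde g(y,\eta)\le\delta\}$, and let $P_C$ be the projection onto a nonempty closed convex set $C$ (here in the Hilbert direct sum $\mathcal H\oplus\mathbb R\oplus\mathbb R$): $P_C(z)$ is the unique point of $C$ nearest to $z$. **Proposition.**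 Let $\varphi\in\Gamma_0(\mathbb R)$ be even, supercoercive (that is, $\varphi(t)/|t|\to+\infty$ as $|t|\to+\infty$) and finite everywhere, set $f=\varphi\circ\|\cdot\|\colon\mathcal H\to\mathbb R$, and let $(x,\eta,\delta)\in\mathcal H\times\mathbb R\times\mathbb R$. Then $\varphi^*$ is finite everywhere, $\operatorname{prox}_{c\varphi}$ and $\operatorname{prox}_{c\varphi^*}$ are well defined on $\mathbb R$ for every $c>0$, and $$P_{\operatorname{epi}\widetilde f}(x,\eta,\delta)=\begin{cases} (x,\max\{\eta,0\},\delta),&\text{if }\widetilde\varphi(\|x\|,\max\{\eta,0\})\le\delta;\\[1mm] (0,0,0),&\text{if }\widetilde\varphi(\|x\|,\max\{\eta,0\})>\delta,\ \delta<0,\text{ and }\eta-\delta\varphi^*\!\left(\frac{\|x\|}{-\delta}\right)\le0;\\[1mm] \left(0,\frac{\eta-\delta\varphi^*(0)}{1+(\varphi^*(0))^2},\frac{\varphi^*(0)(\delta\varphi^*(0)-\eta)}{1+(\varphi^*(0))^2}\right),&\text{if }\widetilde\varphi(\|x\|,\max\{\eta,0\})>\delta,\ \eta-\delta\varphi^*(0)>0,\text{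 and }x=0;\\[2mm] \left(\operatorname{prox}_{\frac{\mu}{\nu}\varphi}\!\left(\frac{\|x\|}{\nu}\right)\frac{\nu x}{\|x\|},\ \nu,\ \delta+\mu\right),&\text{otherwise.} \end{cases}$$ In the last case $x\neq0$, and $(\mu,\nu)\in\,]0,+\infty[^2$ is the unique pair of positive numbers that solves the system $$\mu+\delta=\nu\,\varphi\!\left(\operatorname{prox}_{\frac{\mu}{\nu}\varphi}\!\left(\frac{\|x\|}{\nu}\right)\right),\qquad \nu-\eta=\mu\,\varphi^*\!\left(\operatorname{prox}_{\frac{\nu}{\mu}\varphi^*}\!\left(\frac{\|x\|}{\mu}\right)\right).$$ -/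

import Mathlib

open Filter Topology

noncomputable section

namespace ConvexPersp

section General

variable {E : Type*} [NormedAddCommGroup E] [InnerProductSpace ℝ E]

/-- Effective domain of an extended-real-valued function. -/
def effDom (f : E → EReal) : Set E := {x | f x < ⊤}

/-- The class `Γ₀(E)` of proper lower semicontinuous convex functions `E → ]-∞, +∞]`. -/
structure IsGammaZero (f : E → EReal) : Prop where
  ne_bot : ∀ x, f x ≠ ⊥
  nonempty_dom : (effDom f).Nonempty
  lsc : LowerSemicontinuous f
  convex : ∀ x y : E, ∀ a b : ℝ, 0 < a → 0 < b → a + b = 1 →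
    f (a • x + b • y) ≤ (a : EReal) * f x + (b : EReal) * f y

/-- Supercoercivity: `f x / ‖x‖ → +∞` as `‖x‖ → +∞`. -/
def Supercoercive (f : E → EReal) : Prop :=
  Tendsto (fun x => f x / ((‖x‖ : ℝ) : EReal)) (Bornology.cobounded E) (𝓝 ⊤)

/-- The Fenchel conjugate `f* u = sup_x (⟪x, u⟫ - f x)`. -/
def conj (f : E → EReal) (u : E) : EReal :=
  ⨆ x : E, ((inner ℝ x u : ℝ) : EReal) - f x

/-- The recession function `(rec f) x = lim_{t → +∞} (f (x₀ + t x) - f x₀) / t`, with `x₀` a point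
of the effective domain. For `f ∈ Γ₀(E)` the difference quotient is nondecreasing in `t`, so the
limit exists in `[-∞, +∞]`; it does not depend on `x₀`. -/
def recession (f : E → EReal) (x : E) : EReal :=
  let x₀ : E := Classical.epsilon (fun y => y ∈ effDom f)
  limUnder atTop (fun t : ℝ => (f (x₀ + t • x) - f x₀) / (t : EReal))

/-- The perspective of `f`, a function on the Hilbert direct sum `E ⊕ ℝ`. -/
def perspective (f : E → EReal) (p : WithLp 2 (E × ℝ)) : EReal :=
  open Classical in
  if 0 < p.snd then (p.snd : EReal) * f (p.snd⁻¹ • p.fst)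
  else if p.snd = 0 then recession f p.fst
  else ⊤

/-- The epigraph of `f`, a subset of the Hilbert direct sum `E ⊕ ℝ`. -/
def epigraph (f : E → EReal) : Set (WithLp 2 (E × ℝ)) :=
  {p | f p.fst ≤ (p.snd : EReal)}

/-- `p = P_C z`: the point `p` is the unique point of `C` nearest to `z`. -/
def IsProjection (C : Set E) (z p : E) : Prop :=
  p ∈ C ∧ ∀ q ∈ C, q ≠ p → ‖z - p‖ < ‖z - q‖

/-- `p` is the unique minimizer of `y ↦ f y + ‖x - y‖² / 2`. -/
def IsProx (f : E → EReal) (x p : E) : Prop :=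
  ∀ y : E, y ≠ p →
    f p + ((‖x - p‖ ^ 2 / 2 : ℝ) : EReal) < f y + ((‖x - y‖ ^ 2 / 2 : ℝ) : EReal)

/-- The proximity operator: `prox f x` is the unique minimizer of `y ↦ f y + ‖x - y‖² / 2`
(an unspecified point if there is no unique minimizer, which does not happen on `Γ₀(E)`). -/
def prox (f : E → EReal) (x : E) : E := Classical.epsilon (IsProx f x)

/-- The function `c f` for a real number `c` (used for `c > 0` only). -/
def scale (c : ℝ) (f : E → EReal) : E → EReal := fun x => (c : EReal) * f x

end General

/-- `(μ, ν)` is a positive solution of the system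
`μ + δ = ν φ(prox_{(μ/ν)φ}(r/ν))`, `ν - η = μ φ*(prox_{(ν/μ)φ*}(r/μ))`. -/
def SolvesSystem (φ : ℝ → EReal) (r η δ μ ν : ℝ) : Prop :=
  0 < μ ∧ 0 < ν ∧
  ((μ + δ : ℝ) : EReal) = (ν : EReal) * φ (prox (scale (μ / ν) φ) (r / ν)) ∧
  ((ν - η : ℝ) : EReal) =
    (μ : EReal) * conj φ (prox (scale (ν / μ) (conj φ)) (r / μ))

/-- The point `(x, η, δ)` of the Hilbert direct sum `(H ⊕ ℝ) ⊕ ℝ`. -/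
def triple {H : Type*} (x : H) (η δ : ℝ) : WithLp 2 (WithLp 2 (H × ℝ) × ℝ) :=
  WithLp.toLp 2 (WithLp.toLp 2 (x, η), δ)

end ConvexPersp

end

open ConvexPersp

open Filter Topology

noncomputable section

namespace ConvexPersp

/-! Supercoercivity makes `φ = F` and `φ* = G` finite, and `epi f̃` becomes the closed convex cone
of all (y, t, s) with t ≥ 0 and u‖y‖ - t G(u) ≤ s for every u (`perspective_radial_le_iff`). A point
p of a cone K is the projection of z exactly when z - p is orthogonal to p and lies in the polar of
K; each branch checks this criterion for its explicit p. In the last branch, the point (‖x‖, η, δ)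
is projected onto the planar-profile cone in ℝ³. The residual has the form (μv, -μG(v), -μ), and
orthogonality forces equality in Fenchel–Young, which is the system (`IsConj.exists_system`).
Conversely every solution gives the projection (`IsConj.isProjection_of_system`). Since μ and ν can
be read off its coordinates, uniqueness of the projection gives uniqueness of the pair. -/

/-! ### Subgradients and proximity operators on the line. -/

/-- `v` is a subgradient of `g` at `b`. -/
def IsSubgradient (g : ℝ → ℝ) (v b : ℝ) : Prop := ∀ y, g b + v * (y - b) ≤ g y

theorem exists_isSubgradient {g : ℝ → ℝ} (hg : ConvexOn ℝ Set.univ g) (b : ℝ) :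
    ∃ v, IsSubgradient g v b := by
  have hb : b ∈ interior (Set.univ : Set ℝ) := by simp
  refine ⟨derivWithin g (Set.Ioi b) b, fun y => ?_⟩
  rcases lt_trichotomy b y with h | rfl | h
  · have := hg.rightDeriv_le_slope_of_mem_interior hb (Set.mem_univ y) h
    rw [slope_def_field, le_div_iff₀ (sub_pos.2 h)] at this
    linarith
  · simp
  · have h1 := hg.slope_le_leftDeriv_of_mem_interior (Set.mem_univ y) hb h
    have h2 := h1.trans (hg.leftDeriv_le_rightDeriv_of_mem_interior hb)
    rw [slope_def_field, div_le_iff₀ (sub_pos.2 h)] at h2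
    linarith

/-- A convex minimization problem with quadratic penalty: a minimizer gives a subgradient. -/
theorem isSubgradient_of_forall_le {g : ℝ → ℝ} (hg : ConvexOn ℝ Set.univ g) {c t p : ℝ}
    (hc : 0 < c) (hp : ∀ y, c * g p + (t - p) ^ 2 / 2 ≤ c * g y + (t - y) ^ 2 / 2) :
    IsSubgradient g ((t - p) / c) p := by
  intro y
  by_contra! hlt
  set X := c * (g y - g p) - (t - p) * (y - p) with hX
  have hX0 : X < 0 := by
    have h1 : (t - p) / c * (y - p) * c = (t - p) * (y - p) := by field_simp
    nlinarith
  set D := (y - p) ^ 2 with hD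
  have hD0 : 0 ≤ D := sq_nonneg _
  have hDX : 0 < D - X := by linarith
  -- Moving from `p` towards `y` by a fraction s, minimality requires X + sD/2 ≥ 0. This s satisfies
  -- X + sD = sX < 0, so X + sD/2 = (1 + s)X/2 < 0.
  set s := -X / (D - X) with hs
  have hs0 : 0 < s := div_pos (by linarith) hDX
  have hs1 : s ≤ 1 := (div_le_one hDX).2 (by linarith)
  have hsD : s * (D - X) = -X := div_mul_cancel₀ _ hDX.ne'
  have hconv := hg.2 (Set.mem_univ p) (Set.mem_univ y) (sub_nonneg.2 hs1) hs0.le (by ring)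
  simp only [smul_eq_mul] at hconv
  have h2 := hp ((1 - s) * p + s * y)
  have h3 := mul_le_mul_of_nonneg_left hconv hc.le
  have h4 : 0 ≤ s * (X + s * D / 2) := by
    rw [hX, hD]; linarith
  have h5 : 0 ≤ X + s * D / 2 := nonneg_of_mul_nonneg_right h4 hs0
  nlinarith

theorem IsProx.of_isSubgradient {g : ℝ → ℝ} {c t p : ℝ} (hc : 0 < c)
    (h : IsSubgradient g ((t - p) / c) p) :
    IsProx (scale c fun y => (g y : EReal)) t p := by
  intro y hy
  simp only [scale, Real.norm_eq_abs, sq_abs]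
  norm_cast
  have h1 := mul_le_mul_of_nonneg_left (h y) hc.le
  have h2 : c * (g p + (t - p) / c * (y - p)) = c * g p + (t - p) * (y - p) := by field_simp
  have h3 : 0 < (y - p) ^ 2 := by have := sub_ne_zero.2 hy; positivity
  nlinarith

theorem IsProx.unique {E : Type*} [NormedAddCommGroup E] [InnerProductSpace ℝ E]
    {f : E → EReal} {x p q : E} (hp : IsProx f x p) (hq : IsProx f x q) : p = q := by
  by_contra h
  exact lt_asymm (hp q (Ne.symm h)) (hq p h)

theorem IsProx.prox_eq {E : Type*} [NormedAddCommGroup E] [InnerProductSpace ℝ E]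
    {f : E → EReal} {x p : E} (hp : IsProx f x p) : prox f x = p :=
  IsProx.unique (Classical.epsilon_spec (p := IsProx f x) ⟨p, hp⟩) hp

theorem exists_isSubgradient_prox {g : ℝ → ℝ} (hg : ConvexOn ℝ Set.univ g) {m : ℝ}
    (hm : ∀ y, m ≤ g y) {c : ℝ} (hc : 0 < c) (t : ℝ) :
    ∃ p, IsSubgradient g ((t - p) / c) p := by
  have hcont : Continuous g := by
    have := hg.continuousOn_interior
    rwa [interior_univ, continuousOn_univ] at this
  have hlim : Tendsto (fun y => c * g y + (t - y) ^ 2 / 2) (cocompact ℝ) atTop := by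
    have h1 : Tendsto (fun y : ℝ => |y - t|) (cocompact ℝ) atTop := by
      simpa [Real.dist_eq] using tendsto_dist_right_cocompact_atTop t
    refine tendsto_atTop_mono (fun y => ?_) (tendsto_atTop_add_const_left _ (c * m - 1) h1)
    have := mul_le_mul_of_nonneg_left (hm y) hc.le
    nlinarith [sq_nonneg (|y - t| - 1), sq_abs (y - t)]
  obtain ⟨p, hp⟩ := Continuous.exists_forall_le (by fun_prop) hlim
  exact ⟨p, isSubgradient_of_forall_le hg hc hp⟩

theorem isSubgradient_prox {g : ℝ → ℝ} (hg : ConvexOn ℝ Set.univ g) {m : ℝ}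
    (hm : ∀ y, m ≤ g y) {c : ℝ} (hc : 0 < c) (t : ℝ) :
    IsSubgradient g ((t - prox (scale c fun y => (g y : EReal)) t) / c)
      (prox (scale c fun y => (g y : EReal)) t) := by
  obtain ⟨p, hp⟩ := exists_isSubgradient_prox hg hm hc t
  rwa [(IsProx.of_isSubgradient hc hp).prox_eq]

theorem isProx_prox {g : ℝ → ℝ} (hg : ConvexOn ℝ Set.univ g) {m : ℝ}
    (hm : ∀ y, m ≤ g y) {c : ℝ} (hc : 0 < c) (t : ℝ) :
    IsProx (scale c fun y => (g y : EReal)) t (prox (scale c fun y => (g y : EReal)) t) :=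
  IsProx.of_isSubgradient hc (isSubgradient_prox hg hm hc t)

/-! ### Conjugate pairs and the dual description of the cone. -/

/-- `G` is the (real-valued) conjugate of `F`. -/
def IsConj (F G : ℝ → ℝ) : Prop := ∀ u, IsLUB (Set.range fun r => r * u - F r) (G u)

section Conjugate

variable {F G : ℝ → ℝ}

theorem IsConj.fenchel_young (h : IsConj F G) (r u : ℝ) : r * u - F r ≤ G u :=
  (h u).1 ⟨r, rfl⟩

theorem IsConj.le (h : IsConj F G) {u c : ℝ} (hc : ∀ r, r * u - F r ≤ c) : G u ≤ c :=
  (h u).2 (by rintro _ ⟨r, rfl⟩; exact hc r)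

theorem IsConj.convexOn (h : IsConj F G) : ConvexOn ℝ Set.univ G := by
  refine ⟨convex_univ, fun u _ v _ a b ha hb hab => h.le fun r => ?_⟩
  have h1 := mul_le_mul_of_nonneg_left (h.fenchel_young r u) ha
  have h2 := mul_le_mul_of_nonneg_left (h.fenchel_young r v) hb
  have h3 : F r = (a + b) * F r := by rw [hab, one_mul]
  simp only [smul_eq_mul]
  rw [h3]
  linarith

theorem IsConj.neg_zero_le (h : IsConj F G) (u : ℝ) : -F 0 ≤ G u := by
  simpa using h.fenchel_young 0 u

theorem IsConj.eq_of_isSubgradient (h : IsConj F G) {v b : ℝ} (hv : IsSubgradient F v b) :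
    G v = b * v - F b :=
  le_antisymm (h.le fun r => by have := hv r; linarith) (h.fenchel_young b v)

theorem IsConj.isSubgradient (h : IsConj F G) {v b : ℝ} (hv : IsSubgradient F v b) :
    IsSubgradient G b v := by
  intro w
  have := h.fenchel_young b w
  rw [h.eq_of_isSubgradient hv]
  linarith

theorem isSubgradient_of_eq (h : IsConj F G) {v b : ℝ} (hv : G v ≤ b * v - F b) :
    IsSubgradient F v b := by
  intro y
  have := h.fenchel_young y v
  linarith

/-- Moreau's decomposition. -/
theorem IsConj.prox_conj_eq (h : IsConj F G) {μ ν r b : ℝ} (hμ : 0 < μ) (hν : 0 < ν)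
    (hb : IsSubgradient F ((r / ν - b) / (μ / ν)) b) :
    prox (scale (ν / μ) fun y => (G y : EReal)) (r / μ) = (r / ν - b) / (μ / ν) := by
  refine (IsProx.of_isSubgradient (div_pos hν hμ) ?_).prox_eq
  -- With v = (r - νb)/μ, the scaled dual residual (r/μ - v)/(ν/μ) is b.
  convert h.isSubgradient hb using 1
  field_simp
  ring

/-- The cone `t F(y / t) ≤ s`, written as an intersection of half-spaces. -/
def MemCone (G : ℝ → ℝ) (y t s : ℝ) : Prop := 0 ≤ t ∧ ∀ u, u * y - t * G u ≤ s

/-- Biconjugation at a point: the supremum of u b - G(u) over u is attained at a subgradient of `F`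
at b and equals F(b). -/
theorem memCone_iff_of_pos (hF : ConvexOn ℝ Set.univ F) (h : IsConj F G) {y t s : ℝ}
    (ht : 0 < t) : MemCone G y t s ↔ t * F (t⁻¹ * y) ≤ s := by
  constructor
  · rintro ⟨-, hu⟩
    obtain ⟨v, hv⟩ := exists_isSubgradient hF (t⁻¹ * y)
    have h1 := hu v
    rw [h.eq_of_isSubgradient hv] at h1
    have h2 : t * (t⁻¹ * y * v - F (t⁻¹ * y)) = y * v - t * F (t⁻¹ * y) := by field_simp
    linarith
  · intro hs
    refine ⟨ht.le, fun u => ?_⟩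
    have h1 := mul_le_mul_of_nonneg_left (h.fenchel_young (t⁻¹ * y) u) ht.le
    have h2 : t * (t⁻¹ * y * u - F (t⁻¹ * y)) = y * u - t * F (t⁻¹ * y) := by field_simp
    linarith

/-- Finiteness of `G` everywhere leaves u y ≤ s for all real u, so the slice t = 0 is only a
half-line. -/
theorem memCone_zero_iff {y s : ℝ} : MemCone G y 0 s ↔ y = 0 ∧ 0 ≤ s := by
  constructor
  · rintro ⟨-, hu⟩
    have h0 := hu 0
    by_cases hy : y = 0
    · exact ⟨hy, by simpa using h0⟩
    · have := hu ((s + 1) / y)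
      rw [div_mul_cancel₀ _ hy] at this
      linarith
  · rintro ⟨rfl, hs⟩
    exact ⟨le_rfl, fun u => by simpa using hs⟩

theorem MemCone.smul {y t s : ℝ} (h : MemCone G y t s) {c : ℝ} (hc : 0 ≤ c) :
    MemCone G (c * y) (c * t) (c * s) :=
  ⟨mul_nonneg hc h.1, fun u => by have := mul_le_mul_of_nonneg_left (h.2 u) hc; linarith⟩

theorem MemCone.add {y t s y' t' s' : ℝ} (h : MemCone G y t s) (h' : MemCone G y' t' s') :
    MemCone G (y + y') (t + t') (s + s') :=
  ⟨add_nonneg h.1 h'.1, fun u => by have := h.2 u; have := h'.2 u; linarith⟩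

theorem memCone_one (h : IsConj F G) (b : ℝ) : MemCone G b 1 (F b) :=
  ⟨zero_le_one, fun u => by have := h.fenchel_young b u; linarith⟩

end Conjugate

/-! ### Passage from extended-real to real-valued functions. -/

section Realization

variable {φ : ℝ → EReal}

theorem exists_real_of_effDom_eq_univ (hφ : IsGammaZero φ) (hdom : effDom φ = Set.univ) :
    ∃ F : ℝ → ℝ, φ = (fun r => (F r : EReal)) ∧ ConvexOn ℝ Set.univ F := by
  have hφF : ∀ r, φ r = ((φ r).toReal : EReal) := fun r =>
    (EReal.coe_toReal (ne_of_lt (show r ∈ effDom φ by rw [hdom]; trivial)) (hφ.ne_bot r)).symm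
  refine ⟨fun r => (φ r).toReal, funext hφF, convex_univ, fun x _ y _ a b ha hb hab => ?_⟩
  rcases ha.eq_or_lt with rfl | ha
  · obtain rfl : b = 1 := by linarith
    simp
  rcases hb.eq_or_lt with rfl | hb
  · obtain rfl : a = 1 := by linarith
    simp
  have := hφ.convex x y a b ha hb hab
  rw [hφF x, hφF y, hφF (a • x + b • y)] at this
  exact_mod_cast this

theorem Supercoercive.bddAbove {F : ℝ → ℝ} (hF : ConvexOn ℝ Set.univ F)
    (h : Supercoercive fun r => (F r : EReal)) (u : ℝ) :
    BddAbove (Set.range fun r => r * u - F r) := by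
  have hcont : Continuous F := by
    have := hF.continuousOn_interior
    rwa [interior_univ, continuousOn_univ] at this
  have hev := EReal.tendsto_nhds_top_iff_real.1 h |u|
  rw [hasBasis_cobounded_norm.eventually_iff] at hev
  obtain ⟨R, -, hR⟩ := hev
  obtain ⟨B, hB⟩ := (isCompact_Icc (a := -(max R 1)) (b := max R 1)).bddAbove_image
    (f := fun r => r * u - F r) (by fun_prop)
  refine ⟨max B 0, ?_⟩
  rintro _ ⟨r, rfl⟩
  -- Continuity bounds the compact part; beyond it F(r) > |u||r|, so the expression is negative. The
  -- 1 in the radius keeps |r| positive for the division.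
  by_cases hr : |r| ≤ max R 1
  · exact (hB ⟨r, abs_le.1 hr, rfl⟩).trans (le_max_left _ _)
  · rw [not_le, max_lt_iff] at hr
    have hr0 : 0 < |r| := by linarith
    have h1 := hR (x := r) (by simpa using hr.1.le)
    rw [← EReal.coe_div, EReal.coe_lt_coe_iff, Real.norm_eq_abs, lt_div_iff₀ hr0] at h1
    have h2 : r * u ≤ |u| * |r| := by
      rw [← abs_mul, mul_comm]; exact le_abs_self _
    exact le_max_of_le_right (by simp only; linarith)

theorem exists_conj_eq {F : ℝ → ℝ} (hb : ∀ u, BddAbove (Set.range fun r => r * u - F r)) :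
    ∃ G : ℝ → ℝ, (conj fun r => (F r : EReal)) = (fun u => (G u : EReal)) ∧ IsConj F G := by
  have hlub : ∀ u, IsLUB (Set.range fun r => r * u - F r) (⨆ r, (r * u - F r)) := fun u =>
    isLUB_ciSup (hb u)
  refine ⟨fun u => ⨆ r, (r * u - F r), funext fun u => ?_, hlub⟩
  have key : ∀ r : ℝ, ((inner ℝ r u : ℝ) : EReal) - (F r : EReal)
      = ((r * u - F r : ℝ) : EReal) := fun r => by
    simp [mul_comm]
  simp only [conj, key]
  refine le_antisymm (iSup_le fun r => EReal.coe_le_coe_iff.2 ((hlub u).1 ⟨r, rfl⟩)) ?_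
  refine EReal.le_of_forall_lt_iff_le.1 fun z hz => ?_
  have hz' : ∀ r, r * u - F r ≤ z := fun r =>
    EReal.coe_le_coe_iff.1 ((le_iSup (fun r => ((r * u - F r : ℝ) : EReal)) r).trans hz.le)
  exact EReal.coe_le_coe_iff.2 (ciSup_le hz')

end Realization

/-! ### The epigraph of the perspective of a radial function. -/

section Radial

variable {E : Type*} [NormedAddCommGroup E] [InnerProductSpace ℝ E] {F G : ℝ → ℝ}

theorem recession_radial_zero : recession (fun y : E => (F ‖y‖ : EReal)) 0 = 0 := by
  have : (fun t : ℝ => ((0 : EReal)) / (t : EReal)) = fun _ => 0 := by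
    funext t; simp
  simp only [recession, smul_zero, add_zero]
  rw [← EReal.coe_sub, sub_self, EReal.coe_zero, this]
  exact tendsto_const_nhds.limUnder_eq

theorem recession_radial_of_ne_zero (h : IsConj F G) {y : E} (hy : y ≠ 0) :
    recession (fun y : E => (F ‖y‖ : EReal)) y = ⊤ := by
  unfold recession
  refine Tendsto.limUnder_eq ?_
  set x₀ : E := Classical.epsilon (fun z => z ∈ effDom fun y : E => (F ‖y‖ : EReal))
  have hy0 : 0 < ‖y‖ := norm_pos_iff.2 hy
  refine EReal.tendsto_nhds_top_iff_real.2 fun A => ?_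
  -- Fenchel–Young at slope B makes F(‖x₀ + ty‖) grow at least like t(|A| + 1) up to constants; the
  -- spare t absorbs them.
  set B := (|A| + 1) / ‖y‖
  have hB : B * ‖y‖ = |A| + 1 := div_mul_cancel₀ _ hy0.ne'
  have hB0 : 0 ≤ B := by positivity
  filter_upwards [eventually_gt_atTop 0, eventually_gt_atTop (B * ‖x₀‖ + G B + F ‖x₀‖)]
    with t ht ht'
  rw [← EReal.coe_sub, ← EReal.coe_div, EReal.coe_lt_coe_iff, lt_div_iff₀ ht]
  have h1 := h.fenchel_young ‖x₀ + t • y‖ B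
  have h2 : t * ‖y‖ ≤ ‖x₀ + t • y‖ + ‖x₀‖ := by
    have := norm_sub_le (x₀ + t • y) x₀
    rwa [add_sub_cancel_left, norm_smul, Real.norm_of_nonneg ht.le] at this
  have h3 := mul_le_mul_of_nonneg_left h2 hB0
  have h4 : B * (t * ‖y‖) = t * (|A| + 1) := by rw [← hB]; ring
  nlinarith [le_abs_self A]

theorem perspective_radial_le_iff (hF : ConvexOn ℝ Set.univ F) (h : IsConj F G)
    (y : E) (t s : ℝ) :
    perspective (fun y : E => (F ‖y‖ : EReal)) (WithLp.toLp 2 (y, t)) ≤ (s : EReal) ↔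
      MemCone G ‖y‖ t s := by
  rcases lt_trichotomy 0 t with ht | rfl | ht
  · have : perspective (fun y : E => (F ‖y‖ : EReal)) (WithLp.toLp 2 (y, t))
        = (t : EReal) * (F ‖t⁻¹ • y‖ : EReal) := if_pos ht
    rw [this, memCone_iff_of_pos hF h ht, ← EReal.coe_mul, EReal.coe_le_coe_iff, norm_smul,
      norm_inv, Real.norm_of_nonneg ht.le]
  · have : perspective (fun y : E => (F ‖y‖ : EReal)) (WithLp.toLp 2 (y, 0))
        = recession (fun y : E => (F ‖y‖ : EReal)) y :=
      (if_neg (lt_irrefl _)).trans (if_pos rfl)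
    rw [this, memCone_zero_iff, norm_eq_zero]
    by_cases hy : y = 0
    · subst hy
      rw [recession_radial_zero]
      simp
    · simp [recession_radial_of_ne_zero h hy, hy]
  · have : perspective (fun y : E => (F ‖y‖ : EReal)) (WithLp.toLp 2 (y, t)) = ⊤ :=
      (if_neg ht.not_gt).trans (if_neg ht.ne)
    rw [this]
    simp only [top_le_iff, EReal.coe_ne_top, false_iff]
    exact fun hm => ht.not_ge hm.1

theorem triple_mem_epigraph_iff (hF : ConvexOn ℝ Set.univ F) (h : IsConj F G) (y : E) (t s : ℝ) :
    triple y t s ∈ epigraph (perspective fun y : E => (F ‖y‖ : EReal)) ↔ MemCone G ‖y‖ t s :=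
  perspective_radial_le_iff hF h y t s

theorem inner_triple (x y : E) (a b c d : ℝ) :
    inner ℝ (triple x a b) (triple y c d) = inner ℝ x y + a * c + b * d := by
  simp [triple, WithLp.prod_inner_apply, mul_comm]

theorem triple_sub {E : Type*} [NormedAddCommGroup E] (x y : E) (a b c d : ℝ) :
    triple x a b - triple y c d = triple (x - y) (a - c) (b - d) := rfl

theorem triple_eta {E : Type*} (q : WithLp 2 (WithLp 2 (E × ℝ) × ℝ)) :
    triple q.fst.fst q.fst.snd q.snd = q := rfl

end Radial

/-! ### Projections onto the cone via its polar. -/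

section Projection

variable {E : Type*} [NormedAddCommGroup E] [InnerProductSpace ℝ E]

theorem IsProjection.of_inner {C : Set E} {z p : E} (hp : p ∈ C)
    (h : ∀ q ∈ C, inner ℝ (z - p) (q - p) ≤ 0) : IsProjection C z p := by
  refine ⟨hp, fun q hq hne => ?_⟩
  have h1 := h q hq
  have h2 : ‖z - q‖ ^ 2 = ‖z - p‖ ^ 2 - 2 * inner ℝ (z - p) (q - p) + ‖q - p‖ ^ 2 := by
    rw [← norm_sub_sq_real]; congr 2; abel
  have h3 : 0 < ‖q - p‖ := norm_pos_iff.2 (sub_ne_zero.2 hne)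
  refine lt_of_pow_lt_pow_left₀ 2 (norm_nonneg _) ?_
  nlinarith [pow_pos h3 2]

theorem IsProjection.unique {E : Type*} [NormedAddCommGroup E] {C : Set E} {z p q : E} (hp : IsProjection C z p)
    (hq : IsProjection C z q) : p = q := by
  by_contra h
  exact lt_asymm (hp.2 q hq.1 (Ne.symm h)) (hq.2 p hp.1 h)

variable {F G : ℝ → ℝ}

/-- For q in the cone, ⟨z - p, q - p⟩ = ⟨z - p, q⟩ - ⟨z - p, p⟩, where the first term is nonpositive
and the second nonnegative. -/
theorem isProjection_epigraph_perspective (hF : ConvexOn ℝ Set.univ F) (h : IsConj F G)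
    {x y : E} {η δ t s : ℝ} (hmem : MemCone G ‖y‖ t s)
    (horth : 0 ≤ inner ℝ (x - y) y + (η - t) * t + (δ - s) * s)
    (hpolar : ∀ (w : E) (t' s' : ℝ), MemCone G ‖w‖ t' s' →
      inner ℝ (x - y) w + (η - t) * t' + (δ - s) * s' ≤ 0) :
    IsProjection (epigraph (perspective fun y : E => (F ‖y‖ : EReal))) (triple x η δ)
      (triple y t s) := by
  refine IsProjection.of_inner ((triple_mem_epigraph_iff hF h _ _ _).2 hmem) fun q hq => ?_
  rw [← triple_eta q] at hq ⊢
  rw [triple_mem_epigraph_iff hF h] at hq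
  rw [inner_sub_right, triple_sub, inner_triple, inner_triple]
  have := hpolar _ _ _ hq
  linarith

/-- The projection onto the cone in `ℝ³`, through its variational characterization. -/
theorem exists_memCone_orthogonal_polar (G : ℝ → ℝ) (r η δ : ℝ) : ∃ a t s : ℝ, MemCone G a t s ∧
    (r - a) * a + (η - t) * t + (δ - s) * s = 0 ∧
    ∀ a' t' s', MemCone G a' t' s' → (r - a) * a' + (η - t) * t' + (δ - s) * s' ≤ 0 := by
  set K : Set (WithLp 2 (WithLp 2 (ℝ × ℝ) × ℝ)) := {p | MemCone G p.fst.fst p.fst.snd p.snd}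
    with hK
  have hclosed : IsClosed K := by
    have : K = {p | 0 ≤ p.fst.snd} ∩ ⋂ u, {p | u * p.fst.fst - p.fst.snd * G u ≤ p.snd} := by
      ext p; simp [hK, MemCone]
    rw [this]
    refine (isClosed_le (by fun_prop) (by fun_prop)).inter
      (isClosed_iInter fun u => isClosed_le (by fun_prop) (by fun_prop))
  have hconv : Convex ℝ K := fun p hp q hq a b ha hb _ => (hp.smul ha).add (hq.smul hb)
  have h0 : MemCone G 0 0 0 := memCone_zero_iff.2 ⟨rfl, le_rfl⟩
  obtain ⟨p, hp, hmin⟩ := exists_norm_eq_iInf_of_complete_convex ⟨triple 0 0 0, h0⟩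
    hclosed.isComplete hconv (triple r η δ)
  rw [norm_eq_iInf_iff_real_inner_le_zero hconv hp] at hmin
  have key : ∀ a' t' s', MemCone G a' t' s' → (r - p.fst.fst) * (a' - p.fst.fst)
      + (η - p.fst.snd) * (t' - p.fst.snd) + (δ - p.snd) * (s' - p.snd) ≤ 0 := by
    intro a' t' s' hm
    have h1 := hmin (triple a' t' s') hm
    rw [← triple_eta p, triple_sub, triple_sub, inner_triple] at h1
    have h2 : inner ℝ (r - p.fst.fst) (a' - p.fst.fst)
        = (r - p.fst.fst) * (a' - p.fst.fst) := by simp [mul_comm]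
    rwa [h2] at h1
  refine ⟨p.fst.fst, p.fst.snd, p.snd, hp, ?_, fun a' t' s' hm => ?_⟩
  -- Testing with 0 and 2p gives orthogonality; testing with p + q gives polarity.
  · have h1 := key _ _ _ h0
    have h2 := key _ _ _ (MemCone.add hp hp)
    linarith
  · have h1 := key _ _ _ (MemCone.add hp hm)
    linarith

end Projection

/-! ### The system and its equivalence with the projection. -/

section System

variable {F G : ℝ → ℝ}

theorem IsConj.solvesSystem_iff (h : IsConj F G)
    (hconj : (conj fun r => (F r : EReal)) = fun u => (G u : EReal)) {r η δ μ ν b : ℝ}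
    (hμ : 0 < μ) (hν : 0 < ν) (hb : IsSubgradient F ((r / ν - b) / (μ / ν)) b) :
    SolvesSystem (fun r => (F r : EReal)) r η δ μ ν ↔
      μ + δ = ν * F b ∧ ν - η = μ * G ((r / ν - b) / (μ / ν)) := by
  simp only [SolvesSystem, hconj, (IsProx.of_isSubgradient (div_pos hμ hν) hb).prox_eq,
    h.prox_conj_eq hμ hν hb, hμ, hν, true_and]
  norm_cast

/-- Comparing the values at b and -b gives (t - b)b ≥ 0. -/
theorem IsSubgradient.mem_Icc_of_even (heven : Function.Even F) {c t b : ℝ} (hc : 0 < c)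
    (ht : 0 ≤ t) (hb : IsSubgradient F ((t - b) / c) b) : 0 ≤ b ∧ b ≤ t := by
  have h1 := hb (-b)
  rw [heven b] at h1
  constructor
  · by_contra! hlt
    have : 0 < (t - b) / c := div_pos (by linarith) hc
    nlinarith
  · by_contra! hlt
    have : (t - b) / c < 0 := div_neg_of_neg_of_pos (by linarith) hc
    nlinarith

variable {E : Type*} [NormedAddCommGroup E] [InnerProductSpace ℝ E]

/-- A solution of the system yields the projection. -/
theorem IsConj.isProjection_of_system (h : IsConj F G) (hF : ConvexOn ℝ Set.univ F)
    (heven : Function.Even F) {x : E} (hx : x ≠ 0) {η δ μ ν b : ℝ}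
    (hμ : 0 < μ) (hν : 0 < ν) (hb : IsSubgradient F ((‖x‖ / ν - b) / (μ / ν)) b)
    (h1 : μ + δ = ν * F b) (h2 : ν - η = μ * G ((‖x‖ / ν - b) / (μ / ν))) :
    IsProjection (epigraph (perspective fun y : E => (F ‖y‖ : EReal))) (triple x η δ)
      (triple ((b * (ν / ‖x‖)) • x) ν (δ + μ)) := by
  have hx0 : 0 < ‖x‖ := norm_pos_iff.2 hx
  obtain ⟨hb0, hb1⟩ := hb.mem_Icc_of_even heven (div_pos hμ hν) (div_nonneg hx0.le hν.le)
  have hnorm : ‖(b * (ν / ‖x‖)) • x‖ = ν * b := by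
    rw [norm_smul, Real.norm_of_nonneg (by positivity)]
    field_simp
  have hv : (‖x‖ / ν - b) / (μ / ν) = (‖x‖ - ν * b) / μ := by field_simp
  have hbv := h.eq_of_isSubgradient hb
  rw [hv] at h2 hbv hb
  set v := (‖x‖ - ν * b) / μ with hvdef
  have hv' : μ * v = ‖x‖ - ν * b := mul_div_cancel₀ _ hμ.ne'
  have hνb : ν * b ≤ ‖x‖ := by rwa [le_div_iff₀ hν, mul_comm] at hb1
  have hsub : x - (b * (ν / ‖x‖)) • x = ((‖x‖ - ν * b) / ‖x‖) • x := by
    rw [show (‖x‖ - ν * b) / ‖x‖ = 1 - b * (ν / ‖x‖) by field_simp, sub_smul, one_smul]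
  refine isProjection_epigraph_perspective hF h ?_ ?_ ?_
  · rw [hnorm]
    convert (memCone_one h b).smul hν.le using 1 <;> linarith
  -- The full inner product is μν(bv - G(v) - F(b)), which vanishes by equality in Fenchel–Young.
  · have : inner ℝ (x - (b * (ν / ‖x‖)) • x) ((b * (ν / ‖x‖)) • x)
        = (‖x‖ - ν * b) * (ν * b) := by
      rw [hsub, real_inner_smul_left, real_inner_smul_right, real_inner_self_eq_norm_sq]
      field_simp
    rw [this, ← hv', show η - ν = -(μ * G v) by linarith, hbv, show δ + μ = ν * F b by linarith,
      show δ - ν * F b = -μ by linarith]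
    apply le_of_eq
    ring
  · intro w t s hm
    -- By νb ≤ ‖x‖ the residual is a nonnegative multiple of x of norm μv, so Cauchy–Schwarz reduces
    -- polarity to μ times the half-space inequality at u = v.
    have hle : inner ℝ (x - (b * (ν / ‖x‖)) • x) w ≤ (‖x‖ - ν * b) * ‖w‖ := by
      refine (real_inner_le_norm _ _).trans_eq ?_
      rw [hsub, norm_smul, Real.norm_of_nonneg (div_nonneg (by linarith) hx0.le),
        div_mul_cancel₀ _ hx0.ne']
    rw [← hv'] at hle
    have := mul_le_mul_of_nonneg_left (hm.2 v) hμ.le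
    rw [show η - ν = -(μ * G v) by linarith]
    linarith

/-- Existence of a solution of the system outside of the cone and of its polar. -/
theorem IsConj.exists_system (h : IsConj F G) (hF : ConvexOn ℝ Set.univ F) {r η δ : ℝ}
    (hr : 0 < r) (hmem : ¬ MemCone G r (max η 0) δ)
    (hpolar : ¬ (δ < 0 ∧ η - δ * G (r / (-δ)) ≤ 0)) :
    ∃ μ ν b : ℝ, 0 < μ ∧ 0 < ν ∧ IsSubgradient F ((r / ν - b) / (μ / ν)) b ∧
      μ + δ = ν * F b ∧ ν - η = μ * G ((r / ν - b) / (μ / ν)) := by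
  obtain ⟨a, ν, s, hK, horth, hpol⟩ := exists_memCone_orthogonal_polar G r η δ
  have hμ0 : 0 ≤ s - δ := by
    have := hpol 0 0 1 (memCone_zero_iff.2 ⟨rfl, zero_le_one⟩)
    linarith
  have hpolF : ∀ y, (r - a) * y + (η - ν) ≤ (s - δ) * F y := fun y => by
    have := hpol _ _ _ (memCone_one h y)
    linarith
  -- If s = δ, an affine function of y is bounded above, so r = a; orthogonality then gives η = ν
  -- and the point was already in the cone.
  have hμ : 0 < s - δ := by
    refine lt_of_le_of_ne hμ0 fun h0 => ?_
    have hsδ : s = δ := by linarith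
    rw [hsδ] at hK horth hpolF
    simp only [sub_self, zero_mul, add_zero] at horth hpolF
    have ha : r = a := by
      by_contra hne
      have := hpolF ((ν - η + 1) / (r - a))
      rw [mul_div_cancel₀ _ (sub_ne_zero.2 hne)] at this
      linarith
    subst ha
    have hην : η ≤ ν := by have := hpolF 0; linarith
    rcases hK.1.eq_or_lt with h0 | hν
    · rw [← h0] at hK
      exact hr.ne' (memCone_zero_iff.1 hK).1
    · have : η = ν := by
        have : (η - ν) * ν = 0 := by linarith
        rcases mul_eq_zero.1 this with h' | h' <;> linarith
      rw [this, max_eq_left hν.le] at hmem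
      exact hmem hK
  -- If ν = 0 the projection is the origin, and the polar inequalities, after a supremum over y, are
  -- the excluded second branch.
  have hν : 0 < ν := by
    refine lt_of_le_of_ne hK.1 fun h0 => ?_
    subst h0
    obtain ⟨rfl, hs⟩ := memCone_zero_iff.1 hK
    have hs0 : s = 0 := by
      have : (s - δ) * s = 0 := by linarith
      exact (mul_eq_zero.1 this).resolve_left hμ.ne'
    subst hs0
    have hδ : 0 < -δ := by linarith
    refine hpolar ⟨by linarith, ?_⟩
    have : G (r / -δ) ≤ -η / -δ := h.le fun y => by
      rw [le_div_iff₀ hδ]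
      have h1 := hpolF y
      have h2 : y * (r / -δ) * -δ = y * r := by rw [mul_assoc, div_mul_cancel₀ _ hδ.ne']
      linarith
    rw [le_div_iff₀ hδ] at this
    linarith
  set μ := s - δ with hμdef
  set b := a / ν with hbdef
  set v := (r - a) / μ with hvdef
  have hνb : ν * b = a := mul_div_cancel₀ _ hν.ne'
  have hμv : μ * v = r - a := mul_div_cancel₀ _ hμ.ne'
  have hv : (r / ν - b) / (μ / ν) = v := by
    rw [hbdef, hvdef]; field_simp
  have hG : μ * G v ≤ ν - η := by
    rw [mul_comm, ← le_div_iff₀ hμ]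
    refine h.le fun y => ?_
    rw [le_div_iff₀ hμ]
    have h1 := hpolF y
    rw [← hμv] at h1
    linarith
  have hs : ν * F b ≤ s := by
    have := (memCone_iff_of_pos hF h hν).1 hK
    rwa [inv_mul_eq_div] at this
  have hFY := h.fenchel_young b v
  -- `μ ν (F b + G v) ≤ μ s + ν (ν - η) = μ ν b v`
  have hsum : μ * s + ν * (ν - η) = μ * ν * (b * v) := by
    have : μ * ν * (b * v) = (μ * v) * (ν * b) := by ring
    rw [this, hμv, hνb]
    linarith
  have e1 : μ * (ν * F b) ≤ μ * s := mul_le_mul_of_nonneg_left hs hμ.le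
  have e2 : ν * (μ * G v) ≤ ν * (ν - η) := mul_le_mul_of_nonneg_left hG hν.le
  have e3 : μ * ν * (b * v - F b) ≤ μ * ν * G v :=
    mul_le_mul_of_nonneg_left hFY (mul_pos hμ hν).le
  -- `e1`, `e2`, `e3` and `hsum` close into a cycle, so all three inequalities are equalities.
  refine ⟨μ, ν, b, hμ, hν, ?_, ?_, ?_⟩
  · rw [hv]
    refine isSubgradient_of_eq h ?_
    refine le_of_mul_le_mul_left (a := μ * ν) ?_ (mul_pos hμ hν)
    linarith
  · have : μ * s ≤ μ * (ν * F b) := by linarith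
    have := le_of_mul_le_mul_left this hμ
    linarith
  · rw [hv]
    have : ν * (ν - η) ≤ ν * (μ * G v) := by linarith
    exact le_antisymm (le_of_mul_le_mul_left this hν) hG

end System

/-! ### The three explicit branches. -/

section Branches

variable {F G : ℝ → ℝ} {E : Type*} [NormedAddCommGroup E] [InnerProductSpace ℝ E]

/-- The residual is (0, min(η, 0), 0), which is polar because t ≥ 0 on the cone. -/
theorem IsConj.isProjection_of_mem (h : IsConj F G) (hF : ConvexOn ℝ Set.univ F) {x : E}
    {η δ : ℝ} (hmem : MemCone G ‖x‖ (max η 0) δ) :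
    IsProjection (epigraph (perspective fun y : E => (F ‖y‖ : EReal))) (triple x η δ)
      (triple x (max η 0) δ) := by
  refine isProjection_epigraph_perspective hF h hmem ?_ fun w t s hm => ?_
  · simp only [sub_self, inner_zero_left, zero_mul, zero_add, add_zero]
    rcases le_total η 0 with h0 | h0
    · simp [max_eq_right h0]
    · simp [max_eq_left h0]
  · simp only [sub_self, inner_zero_left, zero_mul, zero_add, add_zero]
    exact mul_nonpos_of_nonpos_of_nonneg (sub_nonpos.2 (le_max_left _ _)) hm.1

/-- The point itself lies in the polar cone: multiply the half-space inequality at u = ‖x‖/(-δ) by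
-δ. -/
theorem IsConj.isProjection_zero (h : IsConj F G) (hF : ConvexOn ℝ Set.univ F) {x : E}
    {η δ : ℝ} (hδ : δ < 0) (hη : η - δ * G (‖x‖ / (-δ)) ≤ 0) :
    IsProjection (epigraph (perspective fun y : E => (F ‖y‖ : EReal))) (triple x η δ)
      (triple 0 0 0) := by
  refine isProjection_epigraph_perspective hF h ?_ (by simp) fun w t s hm => ?_
  · rw [norm_zero]
    exact memCone_zero_iff.2 ⟨rfl, le_rfl⟩
  · simp only [sub_zero]
    have h1 := real_inner_le_norm x w
    have h2 := mul_le_mul_of_nonneg_left (hm.2 (‖x‖ / (-δ))) (neg_nonneg.2 hδ.le)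
    have h3 : -δ * (‖x‖ / (-δ)) = ‖x‖ := mul_div_cancel₀ _ (neg_pos.2 hδ).ne'
    have h4 : -δ * (‖x‖ / (-δ) * ‖w‖) = ‖x‖ * ‖w‖ := by rw [← mul_assoc, h3]
    have h5 := mul_nonpos_of_nonneg_of_nonpos hm.1 hη
    linarith

/-- An even convex function is minimal at 0. -/
theorem IsConj.conj_zero (h : IsConj F G) (hF : ConvexOn ℝ Set.univ F)
    (heven : Function.Even F) : G 0 = -F 0 := by
  refine le_antisymm (h.le fun r => ?_) (h.neg_zero_le 0)
  have h1 := hF.2 (Set.mem_univ r) (Set.mem_univ (-r)) (by norm_num : (0 : ℝ) ≤ 1 / 2)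
    (by norm_num : (0 : ℝ) ≤ 1 / 2) (by norm_num)
  rw [heven r] at h1
  simp only [smul_eq_mul, mul_neg, add_neg_cancel] at h1
  linarith

/-- The projection lies on the ray through (0, 1, F(0)) = (0, 1, -G(0)). The residual is a
nonpositive multiple of (0, G(0), 1), hence polar by the half-space at u = 0. -/
theorem IsConj.isProjection_of_eq_zero (h : IsConj F G) (hF : ConvexOn ℝ Set.univ F)
    (heven : Function.Even F) {η δ : ℝ} (hmem : ¬ MemCone G 0 (max η 0) δ)
    (hη : 0 < η - δ * G 0) :
    IsProjection (epigraph (perspective fun y : E => (F ‖y‖ : EReal))) (triple 0 η δ)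
      (triple 0 ((η - δ * G 0) / (1 + G 0 ^ 2)) (G 0 * (δ * G 0 - η) / (1 + G 0 ^ 2))) := by
  have hG := h.conj_zero hF heven
  have hδ : δ ≤ -(η * G 0) := by
    rcases le_or_gt η 0 with h0 | h0
    · rw [max_eq_right h0, memCone_zero_iff] at hmem
      have hδ : δ < 0 := by
        by_contra! hc
        exact hmem ⟨rfl, hc⟩
      have : 0 < G 0 := by nlinarith
      nlinarith
    · rw [max_eq_left h0.le, memCone_iff_of_pos hF h h0] at hmem
      simp only [mul_zero] at hmem
      rw [hG]
      linarith
  set g := G 0 with hg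
  have hpos : 0 < 1 + g ^ 2 := by positivity
  set τ := (η - δ * g) / (1 + g ^ 2) with hτ
  have hτ0 : 0 < τ := div_pos hη hpos
  have hs : g * (δ * g - η) / (1 + g ^ 2) = -(τ * g) := by rw [hτ]; ring
  have hτ' : τ * (1 + g ^ 2) = η - δ * g := div_mul_cancel₀ _ hpos.ne'
  rw [hs]
  refine isProjection_epigraph_perspective hF h ?_ ?_ fun w t s hm => ?_
  · rw [norm_zero]
    convert (memCone_one h 0).smul hτ0.le using 1
    · simp
    · simp
    · rw [hG]; ring
  · rw [sub_self, inner_zero_left]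
    apply le_of_eq
    linear_combination τ * hτ'
  · rw [sub_self, inner_zero_left]
    have h1 := hm.2 0
    rw [zero_mul, zero_sub, ← hg] at h1
    -- the residual is a nonpositive multiple of `(g, 1)`
    have h2 : η - τ = (δ + τ * g) * g := by linear_combination -hτ'
    have h3 : δ + τ * g ≤ 0 := by
      have : (δ + τ * g) * (1 + g ^ 2) ≤ 0 := by
        have : (δ + τ * g) * (1 + g ^ 2) = δ + η * g := by linear_combination g * hτ'
        linarith
      by_contra! hc
      exact absurd (mul_pos hc hpos) this.not_gt
    have h4 := mul_nonpos_of_nonpos_of_nonneg h3 (show 0 ≤ s + t * g by linarith)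
    rw [h2]
    linarith

end Branches

end ConvexPersp

end

/-! ### Assembly of the proposition. -/

open ConvexPersp

theorem proposition3p4 {H : Type*} [NormedAddCommGroup H] [InnerProductSpace ℝ H]
    [CompleteSpace H] (φ : ℝ → EReal) (hφ : IsGammaZero φ) (heven : Function.Even φ)
    (hsuper : Supercoercive φ) (hdom : effDom φ = Set.univ) (x : H) (η δ : ℝ) :
    -- the objects in the formula are well defined
    (∀ u : ℝ, conj φ u ≠ ⊥ ∧ conj φ u ≠ ⊤) ∧
    (∀ c : ℝ, 0 < c → ∀ t : ℝ, IsProx (scale c φ) t (prox (scale c φ) t) ∧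
      IsProx (scale c (conj φ)) t (prox (scale c (conj φ)) t)) ∧
    -- first branch
    (perspective φ (WithLp.toLp 2 (‖x‖, max η 0)) ≤ (δ : EReal) →
      IsProjection (epigraph (perspective fun y : H => φ ‖y‖)) (triple x η δ)
        (triple x (max η 0) δ)) ∧
    -- second branch
    ((δ : EReal) < perspective φ (WithLp.toLp 2 (‖x‖, max η 0)) ∧ δ < 0 ∧
        (η : EReal) - (δ : EReal) * conj φ (‖x‖ / (-δ)) ≤ 0 →
      IsProjection (epigraph (perspective fun y : H => φ ‖y‖)) (triple x η δ)
        (triple 0 0 0)) ∧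
    -- third branch
    ((δ : EReal) < perspective φ (WithLp.toLp 2 (‖x‖, max η 0)) ∧
        0 < (η : EReal) - (δ : EReal) * conj φ 0 ∧ x = 0 →
      IsProjection (epigraph (perspective fun y : H => φ ‖y‖)) (triple x η δ)
        (triple 0 ((η - δ * (conj φ 0).toReal) / (1 + (conj φ 0).toReal ^ 2))
          ((conj φ 0).toReal * (δ * (conj φ 0).toReal - η) / (1 + (conj φ 0).toReal ^ 2)))) ∧
    -- fourth branch: all remaining cases
    (¬ (perspective φ (WithLp.toLp 2 (‖x‖, max η 0)) ≤ (δ : EReal)) →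
      ¬ ((δ : EReal) < perspective φ (WithLp.toLp 2 (‖x‖, max η 0)) ∧ δ < 0 ∧
        (η : EReal) - (δ : EReal) * conj φ (‖x‖ / (-δ)) ≤ 0) →
      ¬ ((δ : EReal) < perspective φ (WithLp.toLp 2 (‖x‖, max η 0)) ∧
        0 < (η : EReal) - (δ : EReal) * conj φ 0 ∧ x = 0) →
      x ≠ 0 ∧
      ∃ μ ν : ℝ, SolvesSystem φ ‖x‖ η δ μ ν ∧
        (∀ μ' ν' : ℝ, SolvesSystem φ ‖x‖ η δ μ' ν' → μ' = μ ∧ ν' = ν) ∧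
        IsProjection (epigraph (perspective fun y : H => φ ‖y‖)) (triple x η δ)
          (triple ((prox (scale (μ / ν) φ) (‖x‖ / ν) * (ν / ‖x‖)) • x) ν (δ + μ))) := by
  obtain ⟨F, rfl, hF⟩ := exists_real_of_effDom_eq_univ hφ hdom
  obtain ⟨G, hconj, h⟩ := exists_conj_eq (hsuper.bddAbove hF)
  have hevenF : Function.Even F := fun r => EReal.coe_injective (heven r)
  have hFG : ∀ r, -G 0 ≤ F r := fun r => by
    have := h.fenchel_young r 0
    linarith
  have hpersp : perspective (fun r : ℝ => (F r : EReal)) (WithLp.toLp 2 (‖x‖, max η 0)) ≤ (δ : EReal)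
      ↔ MemCone G ‖x‖ (max η 0) δ := by
    -- By evenness `φ` is itself radial on ℝ, so the description of the radial perspective also
    -- covers the scalar one.
    have habs : (fun r : ℝ => (F r : EReal)) = fun r : ℝ => (F ‖r‖ : EReal) := by
      funext r
      rcases abs_choice r with hr | hr
      · rw [Real.norm_eq_abs, hr]
      · rw [Real.norm_eq_abs, hr, hevenF r]
    rw [habs, perspective_radial_le_iff hF h, norm_norm]
  have hle : ∀ a b c : ℝ, (a : EReal) - (b : EReal) * (c : EReal) ≤ 0 ↔ a - b * c ≤ 0 := by
    intro a b c
    norm_cast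
  have hlt : ∀ a b c : ℝ, 0 < (a : EReal) - (b : EReal) * (c : EReal) ↔ 0 < a - b * c := by
    intro a b c
    norm_cast
  simp only [← not_le, hpersp, hconj, hle, EReal.toReal_coe]
  simp only [not_le]
  refine ⟨fun u => ⟨EReal.coe_ne_bot _, EReal.coe_ne_top _⟩,
    fun c hc t => ⟨isProx_prox hF hFG hc t, isProx_prox h.convexOn h.neg_zero_le hc t⟩,
    h.isProjection_of_mem hF, fun ⟨_, hδ, hη⟩ => h.isProjection_zero hF hδ hη, ?_, ?_⟩
  · rintro ⟨hmem, hη, rfl⟩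
    rw [norm_zero] at hmem
    exact h.isProjection_of_eq_zero hF hevenF hmem hη
  · intro hmem hpolar hzero
    -- If x = 0, failure of the third branch gives η ≤ δG(0), failure of the second then gives δ ≥
    -- 0, and together they put the point in the first branch.
    have hx : x ≠ 0 := by
      rintro rfl
      rw [norm_zero] at hmem hpolar hzero
      have h1 : η - δ * G 0 ≤ 0 := by
        by_contra! hc
        exact hzero ⟨hmem, hc, rfl⟩
      have h2 : 0 ≤ δ := by
        by_contra! hc
        exact hpolar ⟨hmem, hc, by rwa [zero_div]⟩
      rcases le_or_gt η 0 with h0 | h0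
      · rw [max_eq_right h0] at hmem
        exact hmem (memCone_zero_iff.2 ⟨rfl, h2⟩)
      · rw [max_eq_left h0.le, memCone_iff_of_pos hF h h0, mul_zero] at hmem
        rw [h.conj_zero hF hevenF] at h1
        nlinarith
    have hproj : ∀ μ ν : ℝ, SolvesSystem (fun r => (F r : EReal)) ‖x‖ η δ μ ν →
        IsProjection (epigraph (perspective fun y : H => (F ‖y‖ : EReal))) (triple x η δ)
          (triple ((prox (scale (μ / ν) fun r => (F r : EReal)) (‖x‖ / ν) * (ν / ‖x‖)) • x)
            ν (δ + μ)) := by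
      intro μ ν hsys
      have hb := isSubgradient_prox hF hFG (div_pos hsys.1 hsys.2.1) (‖x‖ / ν)
      obtain ⟨h1, h2⟩ := (h.solvesSystem_iff hconj hsys.1 hsys.2.1 hb).1 hsys
      exact h.isProjection_of_system hF hevenF hx hsys.1 hsys.2.1 hb h1 h2
    obtain ⟨μ, ν, b, hμ, hν, hb, h1, h2⟩ := h.exists_system hF (norm_pos_iff.2 hx) hmem
      fun hc => hpolar ⟨hmem, hc⟩
    have hsys := (h.solvesSystem_iff hconj hμ hν hb).2 ⟨h1, h2⟩
    refine ⟨hx, μ, ν, hsys, fun μ' ν' hsys' => ?_, hproj μ ν hsys⟩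
    -- Both solutions produce the same projection, whose last two coordinates are ν and δ + μ.
    have heq := (hproj μ' ν' hsys').unique (hproj μ ν hsys)
    have e1 : δ + μ' = δ + μ := congrArg (fun p => p.snd) heq
    have e2 : ν' = ν := congrArg (fun p => p.fst.snd) heq
    exact ⟨by linarith, e2⟩
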